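/- Let $0<a<\infty$, $I=(-a,a)$, and let $q\in L^1(I)$ be complex-valued. For $h\in L^1(I)$, a weak solution of $u''-qu=h$ on $I$ is a function $u\in W^{1,1}(I)$ satisfying the equation in the sense of distributions on $I$; functions in $W^{1,1}(I)$ are identified with their representatives that are continuous on $\overline I$ (for weak solutions these are continuously differentiable on $\overline I$). Let $\{\varphi_k\}_{k\ge 0}$ be a standard $L$-base for $L=\frac{d^2}{dx^2}-q$ on $I$, i.e. $\varphi_0,\varphi_1$ are weak solutions of $\varphi''-q\varphi=0$, for every $k\ge2$ the function $\varphi_k$ is a weak solution of $\varphi_k''-q\varphi_k=k(k-1)\varphi_{k-2}$, and $\varphi_k(0)=\varphi_k'(0)=0$ for every $k\ge 2$. Suppose that the Wronskian $W(\varphi_0,\varphi_1)=\varphi_0\varphi_1'-\varphi_0'\varphi_1$ (a constant) is not zero, and let $\lambda\in\mathbb C$. Then the general weak solution of $$v''-qv=\lambda v\quad\text{on } I$$ is $c_1v_1+c_2v_2$ with arbitrary $c_1,c_2\in\mathbb C$; that is, the weak solutions are exactly these functions, where $$v_1=\sum_{k=0}^\infty\lambda^k\frac{\varphi_{2k}}{(2k)!},\qquad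 v_2=\sum_{k=0}^\infty\lambda^k\frac{\varphi_{2k+1}}{(2k+1)!}.$$ Both series converge uniformly on $\overline I$, to $v_1$ and $v_2$, and the corresponding series of derivatives converge uniformly on $\overline I$, to $v_1'$ and $v_2'$. -/

import Mathlib

open Set Filter MeasureTheory
open scoped Topology ContDiff

noncomputable section

/-- `ψ` is a test function on the open interval `(a, b)`, i.e. an element of `C_c^∞(a, b)`. -/
structure IsTestFunction (a b : ℝ) (ψ : ℝ → ℂ) : Prop where
  contDiff : ContDiff ℝ ∞ ψ
  hasCompactSupport : HasCompactSupport ψ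
  tsupport_subset : tsupport ψ ⊆ Ioo a b

/-- `g` is the distributional derivative of `f` on `(a, b)` (to be used for functions that are
integrable on `(a, b)`). -/
def HasWeakDeriv (a b : ℝ) (f g : ℝ → ℂ) : Prop :=
  ∀ ψ : ℝ → ℂ, IsTestFunction a b ψ →
    ∫ x in Ioo a b, g x * ψ x = -∫ x in Ioo a b, f x * deriv ψ x

/-- `f` belongs to the Sobolev space `W^{1,1}(a, b)`. -/
def MemW11 (a b : ℝ) (f : ℝ → ℂ) : Prop :=
  IntegrableOn f (Ioo a b) ∧ ∃ g : ℝ → ℂ, IntegrableOn g (Ioo a b) ∧ HasWeakDeriv a b f g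

/-- `u` is a weak solution of `u'' - q u = h` on `(a, b)`, for `q, h ∈ L¹(a, b)`: `u` belongs to
`W^{1,1}(a, b)` and the equation holds in the sense of distributions. -/
structure IsWeakSolution (a b : ℝ) (q h u : ℝ → ℂ) : Prop where
  memW11 : MemW11 a b u
  eq_distrib : ∀ ψ : ℝ → ℂ, IsTestFunction a b ψ →
    (∫ x in Ioo a b, u x * deriv (deriv ψ) x) - ∫ x in Ioo a b, u x * (q x * ψ x) =
      ∫ x in Ioo a b, h x * ψ x

/-- `φ` is an `L`-base for `L = d²/dx² - q` on `(a, b)`. Elements of `W^{1,1}(a, b)` are classes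
of functions up to equality almost everywhere; as usual each class is identified with its
representative that is continuous on `[a, b]`, which is what `continuousOn` says. -/
structure IsLBase (a b : ℝ) (q : ℝ → ℂ) (φ : ℕ → ℝ → ℂ) : Prop where
  continuousOn : ∀ k, ContinuousOn (φ k) (Icc a b)
  zero : IsWeakSolution a b q (fun _ => 0) (φ 0)
  one : IsWeakSolution a b q (fun _ => 0) (φ 1)
  add_two : ∀ k : ℕ,
    IsWeakSolution a b q (fun x => ((k : ℂ) + 2) * ((k : ℂ) + 1) * φ k x) (φ (k + 2))

/-- `φ` is a standard `L`-base for `L = d²/dx² - q` on `(a, b)` (where `0 ∈ [a, b]`):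
`φ_k(0) = φ_k'(0) = 0` for all `k ≥ 2`. -/
structure IsStandardLBase (a b : ℝ) (q : ℝ → ℂ) (φ : ℕ → ℝ → ℂ) : Prop
    extends IsLBase a b q φ where
  apply_zero : ∀ k, 2 ≤ k → φ k 0 = 0
  deriv_zero : ∀ k, 2 ≤ k → derivWithin (φ k) (Icc a b) 0 = 0

/-- The Wronskian `W(f, g) = f g' - f' g` on `[a, b]` (one-sided derivatives at the ends). -/
def wronskianOn (a b : ℝ) (f g : ℝ → ℂ) (x : ℝ) : ℂ :=
  f x * derivWithin g (Icc a b) x - derivWithin f (Icc a b) x * g x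

/-- `v₁ = ∑_{k ≥ 0} λ^k φ_{2k} / (2k)!`, pointwise. -/
def sppsEven (φ : ℕ → ℝ → ℂ) (lam : ℂ) (x : ℝ) : ℂ :=
  ∑' k : ℕ, lam ^ k * (φ (2 * k) x / ((2 * k).factorial : ℂ))

/-- `v₂ = ∑_{k ≥ 0} λ^k φ_{2k+1} / (2k+1)!`, pointwise. -/
def sppsOdd (φ : ℕ → ℝ → ℂ) (lam : ℂ) (x : ℝ) : ℂ :=
  ∑' k : ℕ, lam ^ k * (φ (2 * k + 1) x / ((2 * k + 1).factorial : ℂ))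

end

/-! Two applications of the du Bois-Reymond lemma turn a weak solution of `u'' - q u = f` into the
integrated system `u' = w`, `w' = q u + f` with base point `c` (`IsPrimitivePair`); conversely every
such pair gives a weak solution. The rest is Cauchy theory for this system at `c = 0`.

The terms `t n = lam ^ n φ_{2n+r} / (2n+r)!` satisfy `t 0'' = q t 0` and `t (n+1)'' = q t (n+1) +
lam t n`, because the factor `k (k - 1)` cancels against the factorial, and every term after the
first has zero Cauchy data at `0`. The series is thus a Neumann series. In the norm weighted by `exp
(-K |x|)`, the operator taking a forcing to the solution with zero data has arbitrarily small norm
once `K` is large, even for merely integrable `q` (`exists_setIntegral_mul_exp_le`,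
`IsPrimitivePair.norm_le_of_forcing`). Hence terms and derivatives decay like `2 ^ (-n)`, both
series converge uniformly, and dominated convergence passes the system to the sum.

The sums carry the data of `φ 0` and `φ 1` at `0`. The Wronskian is nonzero there, so a combination
of them matches the data of any solution, and uniqueness for the potential `q + lam` finishes. -/

namespace IsTestFunction

/-! ### Test functions and their antiderivatives. -/

variable {a b : ℝ} {ψ : ℝ → ℂ}

theorem eq_zero_of_notMem (h : IsTestFunction a b ψ) {x : ℝ} (hx : x ∉ Ioo a b) : ψ x = 0 :=
  image_eq_zero_of_notMem_tsupport fun hx' => hx (h.tsupport_subset hx')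

theorem deriv (h : IsTestFunction a b ψ) : IsTestFunction a b (deriv ψ) where
  contDiff := (contDiff_infty_iff_deriv.1 h.contDiff).2
  hasCompactSupport := h.hasCompactSupport.deriv
  tsupport_subset := (tsupport_deriv_subset (𝕜 := ℝ)).trans h.tsupport_subset

theorem sub_const_mul {θ : ℝ → ℂ} (h : IsTestFunction a b ψ) (hθ : IsTestFunction a b θ) (c : ℂ) :
    IsTestFunction a b fun x => ψ x - c * θ x where
  contDiff := h.contDiff.sub (contDiff_const.mul hθ.contDiff)
  hasCompactSupport := h.hasCompactSupport.sub hθ.hasCompactSupport.mul_left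
  tsupport_subset := (tsupport_sub _ _).trans
    (union_subset h.tsupport_subset ((tsupport_mul_subset_right (f := fun _ => c)).trans
      hθ.tsupport_subset))

theorem continuous (h : IsTestFunction a b ψ) : Continuous ψ := h.contDiff.continuous

theorem hasDerivAt (h : IsTestFunction a b ψ) (x : ℝ) :
    HasDerivAt ψ (_root_.deriv ψ x) x :=
  ((h.contDiff.differentiable (by simp)) x).hasDerivAt

theorem integrable (h : IsTestFunction a b ψ) : Integrable ψ :=
  h.continuous.integrable_of_hasCompactSupport h.hasCompactSupport

theorem integral_deriv_Ioo (h : IsTestFunction a b ψ) {t : ℝ} (ht : t ∈ Icc a b) :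
    ∫ x in Ioo t b, _root_.deriv ψ x = -ψ t := by
  rw [← integral_Ioc_eq_integral_Ioo, ← intervalIntegral.integral_of_le ht.2,
    intervalIntegral.integral_eq_sub_of_hasDerivAt (fun x _ => h.hasDerivAt x)
      (h.deriv.continuous.intervalIntegrable _ _), h.eq_zero_of_notMem (by simp)]
  simp

theorem integrableOn_mul {f : ℝ → ℂ} {s : Set ℝ} (h : IsTestFunction a b ψ)
    (hf : IntegrableOn f s) : IntegrableOn (fun x => f x * ψ x) s := by
  obtain ⟨C, hC⟩ := h.hasCompactSupport.exists_bound_of_continuous h.continuous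
  exact Integrable.mul_bdd hf h.continuous.aestronglyMeasurable (Eventually.of_forall hC)

/-- The primitive from `a` vanishes to the left of the support of `ψ`, and to the right of it
because the total integral is zero. -/
theorem exists_deriv_eq (h : IsTestFunction a b ψ) (h0 : ∫ x in Ioo a b, ψ x = 0) :
    ∃ η, IsTestFunction a b η ∧ _root_.deriv η = ψ := by
  obtain ⟨c, d, hac, hdb, hcd⟩ : ∃ c d, a < c ∧ d < b ∧ tsupport ψ ⊆ Icc c d := by
    rcases (tsupport ψ).eq_empty_or_nonempty with he | hne
    -- Nothing requires `c ≤ d`, so any points on the correct side of `a` and of `b` serve.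
    · exact ⟨a + 1, b - 1, by linarith, by linarith, by simp [he]⟩
    · have hK : IsCompact (tsupport ψ) := h.hasCompactSupport
      exact ⟨_, _, (h.tsupport_subset (hK.sInf_mem hne)).1, (h.tsupport_subset (hK.sSup_mem hne)).2,
        fun x hx => ⟨csInf_le hK.bddBelow hx, le_csSup hK.bddAbove hx⟩⟩
  have hz : ∀ x, x ∉ Icc c d → ψ x = 0 := fun x hx =>
    image_eq_zero_of_notMem_tsupport fun hx' => hx (hcd hx')
  have hder : ∀ x, HasDerivAt (fun x => ∫ t in a..x, ψ t) (ψ x) x := fun x =>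
    intervalIntegral.integral_hasDerivAt_right (h.continuous.intervalIntegrable _ _)
      h.continuous.stronglyMeasurable.stronglyMeasurableAtFilter h.continuous.continuousAt
  have hd : _root_.deriv (fun x => ∫ t in a..x, ψ t) = ψ := funext fun x => (hder x).deriv
  have hsupp : Function.support (fun x => ∫ t in a..x, ψ t) ⊆ Icc c d := by
    intro x hx
    by_contra hx'
    refine hx ?_
    rcases lt_or_ge x c with hxc | hxc
    · refine intervalIntegral.integral_zero_ae (Eventually.of_forall fun t ht => hz t fun htc => ?_)
      have : t ≤ max a x := ht.2
      exact absurd (htc.1.trans this) (not_le.2 (max_lt hac hxc))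
    · have hdx : d < x := by
        by_contra hle
        exact hx' ⟨hxc, not_lt.1 hle⟩
      have hxb : ∫ t in x..b, ψ t = 0 := by
        refine intervalIntegral.integral_zero_ae
          (Eventually.of_forall fun t ht => hz t fun htc => ?_)
        have : min x b < t := ht.1
        exact absurd (this.trans_le htc.2) (not_lt.2 (le_min hdx.le hdb.le))
      rcases le_total a b with hab | hab
      · rw [← integral_Ioc_eq_integral_Ioo, ← intervalIntegral.integral_of_le hab,
          ← intervalIntegral.integral_add_adjacent_intervals
            (h.continuous.intervalIntegrable a x) (h.continuous.intervalIntegrable x b), hxb,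
          add_zero] at h0
        exact h0
      · have : ∀ t, ψ t = 0 := fun t => h.eq_zero_of_notMem (by simp [Ioo_eq_empty (not_lt.2 hab)])
        simp [this]
  refine ⟨_, ⟨contDiff_infty_iff_deriv.2 ⟨fun x => (hder x).differentiableAt, ?_⟩, ?_, ?_⟩, hd⟩
  · rw [hd]; exact h.contDiff
  · exact HasCompactSupport.of_support_subset_isCompact isCompact_Icc hsupp
  · exact (closure_minimal hsupp isClosed_Icc).trans (Icc_subset_Ioo hac hdb)

theorem exists_integral_eq_one (hab : a < b) :
    ∃ θ, IsTestFunction a b θ ∧ ∫ x in Ioo a b, θ x = 1 := by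
  let f : ContDiffBump ((a + b) / 2) := ⟨(b - a) / 8, (b - a) / 4, by linarith, by linarith⟩
  have hsub : tsupport (fun x => ((f.normed volume x : ℝ) : ℂ)) ⊆ Ioo a b := by
    refine (tsupport_comp_subset Complex.ofReal_zero (f.normed volume)).trans ?_
    rw [f.tsupport_normed_eq, Real.closedBall_eq_Icc]
    refine Icc_subset_Ioo ?_ ?_ <;> simp only [f] <;> linarith
  refine ⟨fun x => ((f.normed volume x : ℝ) : ℂ),
    ⟨Complex.ofRealCLM.contDiff.comp f.contDiff_normed,
      f.hasCompactSupport_normed.comp_left Complex.ofReal_zero, hsub⟩, ?_⟩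
  rw [setIntegral_eq_integral_of_forall_compl_eq_zero
    (fun x hx => image_eq_zero_of_notMem_tsupport fun hx' => hx (hsub hx')), integral_complex_ofReal,
    f.integral_normed, Complex.ofReal_one]

end IsTestFunction

/-! ### Weak derivatives, primitives and the du Bois-Reymond lemma. -/

section WeakDerivative

variable {a b c : ℝ} {f g : ℝ → ℂ}

theorem MeasureTheory.IntegrableOn.intervalIntegrable_of_mem_Icc (hg : IntegrableOn g (Ioo a b))
    {x y : ℝ} (hx : x ∈ Icc a b) (hy : y ∈ Icc a b) : IntervalIntegrable g volume x y := by
  refine (intervalIntegrable_iff' ).2 ?_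
  exact (integrableOn_Icc_iff_integrableOn_Ioo).2 hg |>.mono_set (uIcc_subset_Icc hx hy)

theorem continuousOn_primitive_Icc (hg : IntegrableOn g (Ioo a b)) (hc : c ∈ Icc a b) :
    ContinuousOn (fun x => ∫ t in c..x, g t) (Icc a b) := by
  have hab : a ≤ b := hc.1.trans hc.2
  rw [← uIcc_of_le hab]
  exact intervalIntegral.continuousOn_primitive_interval'
    (hg.intervalIntegrable_of_mem_Icc (left_mem_Icc.2 hab) (right_mem_Icc.2 hab))
    (by rwa [uIcc_of_le hab])

theorem ContinuousOn.integrableOn_Ioo (hf : ContinuousOn f (Icc a b)) : IntegrableOn f (Ioo a b) :=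
  hf.integrableOn_Icc.mono_set Ioo_subset_Icc_self

theorem HasWeakDeriv.const (k : ℂ) : HasWeakDeriv a b (fun _ => k) fun _ => 0 := by
  intro ψ hψ
  rcases le_or_gt b a with hab | hab
  · simp [Ioo_eq_empty (not_lt.2 hab)]
  · simp only [zero_mul, integral_zero]
    rw [integral_const_mul, hψ.integral_deriv_Ioo (left_mem_Icc.2 hab.le),
      hψ.eq_zero_of_notMem (by simp)]
    simp

/-- Fubini on the triangle `t < x`: integrating `deriv ψ` over `(t, b)` leaves `-ψ t`. -/
theorem hasWeakDeriv_primitive_left (hg : IntegrableOn g (Ioo a b)) :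
    HasWeakDeriv a b (fun x => ∫ t in a..x, g t) g := by
  intro ψ hψ
  set ν : Measure ℝ := volume.restrict (Ioo a b) with hν
  have hprod : Integrable (fun p : ℝ × ℝ => deriv ψ p.1 * g p.2) (ν.prod ν) :=
    hψ.deriv.integrable.integrableOn.mul_prod hg
  have hT : MeasurableSet {p : ℝ × ℝ | p.2 < p.1} := measurableSet_lt measurable_snd measurable_fst
  have hswap := integral_integral_swap (f := fun x t =>
    {p : ℝ × ℝ | p.2 < p.1}.indicator (fun p : ℝ × ℝ => deriv ψ p.1 * g p.2) (x, t))
    (hprod.indicator hT)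
  have h1 : ∀ x ∈ Ioo a b, ∫ t, {p : ℝ × ℝ | p.2 < p.1}.indicator
      (fun p : ℝ × ℝ => deriv ψ p.1 * g p.2) (x, t) ∂ν = (∫ t in a..x, g t) * deriv ψ x := by
    intro x hx
    have : (fun t => {p : ℝ × ℝ | p.2 < p.1}.indicator
        (fun p : ℝ × ℝ => deriv ψ p.1 * g p.2) (x, t)) =
        (Iio x).indicator fun t => deriv ψ x * g t := by
      ext t; simp [indicator]
    rw [this, integral_indicator measurableSet_Iio, hν, Measure.restrict_restrict measurableSet_Iio,
      integral_const_mul, intervalIntegral.integral_of_le hx.1.le, integral_Ioc_eq_integral_Ioo,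
      mul_comm]
    congr 3
    ext t; simp only [mem_inter_iff, mem_Iio, mem_Ioo]
    constructor
    · rintro ⟨h, h', -⟩; exact ⟨h', h⟩
    · rintro ⟨h, h'⟩; exact ⟨h', h, h'.trans hx.2⟩
  have h2 : ∀ t ∈ Ioo a b, ∫ x, {p : ℝ × ℝ | p.2 < p.1}.indicator
      (fun p : ℝ × ℝ => deriv ψ p.1 * g p.2) (x, t) ∂ν = -(g t * ψ t) := by
    intro t ht
    have : (fun x => {p : ℝ × ℝ | p.2 < p.1}.indicator
        (fun p : ℝ × ℝ => deriv ψ p.1 * g p.2) (x, t)) =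
        (Ioi t).indicator fun x => deriv ψ x * g t := by
      ext x; simp [indicator]
    have hset : Ioi t ∩ Ioo a b = Ioo t b := by
      ext x; simp only [mem_inter_iff, mem_Ioi, mem_Ioo]
      constructor
      · rintro ⟨h, -, h'⟩; exact ⟨h, h'⟩
      · rintro ⟨h, h'⟩; exact ⟨h, ht.1.trans h, h'⟩
    rw [this, integral_indicator measurableSet_Ioi, hν, Measure.restrict_restrict measurableSet_Ioi,
      integral_mul_const, hset, hψ.integral_deriv_Ioo (Ioo_subset_Icc_self ht)]
    ring
  rw [hν, setIntegral_congr_fun measurableSet_Ioo h1, setIntegral_congr_fun measurableSet_Ioo h2,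
    integral_neg] at hswap
  rw [hswap, neg_neg]

theorem HasWeakDeriv.add {f' g' : ℝ → ℂ} (hf : IntegrableOn f (Ioo a b))
    (hf' : IntegrableOn f' (Ioo a b)) (hg : IntegrableOn g (Ioo a b))
    (hg' : IntegrableOn g' (Ioo a b)) (h : HasWeakDeriv a b f g) (h' : HasWeakDeriv a b f' g') :
    HasWeakDeriv a b (fun x => f x + f' x) fun x => g x + g' x := by
  intro ψ hψ
  simp only [add_mul]
  rw [integral_add (hψ.integrableOn_mul hg) (hψ.integrableOn_mul hg'),
    integral_add (hψ.deriv.integrableOn_mul hf) (hψ.deriv.integrableOn_mul hf'), h ψ hψ, h' ψ hψ]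
  ring

theorem HasWeakDeriv.sub {f' g' : ℝ → ℂ} (hf : IntegrableOn f (Ioo a b))
    (hf' : IntegrableOn f' (Ioo a b)) (hg : IntegrableOn g (Ioo a b))
    (hg' : IntegrableOn g' (Ioo a b)) (h : HasWeakDeriv a b f g) (h' : HasWeakDeriv a b f' g') :
    HasWeakDeriv a b (fun x => f x - f' x) fun x => g x - g' x := by
  intro ψ hψ
  simp only [sub_mul]
  rw [integral_sub (hψ.integrableOn_mul hg) (hψ.integrableOn_mul hg'),
    integral_sub (hψ.deriv.integrableOn_mul hf) (hψ.deriv.integrableOn_mul hf'), h ψ hψ, h' ψ hψ]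
  ring

theorem HasWeakDeriv.congr_ae {f' g' : ℝ → ℂ} (h : HasWeakDeriv a b f g)
    (hf : f =ᵐ[volume.restrict (Ioo a b)] f') (hg : g =ᵐ[volume.restrict (Ioo a b)] g') :
    HasWeakDeriv a b f' g' := by
  intro ψ hψ
  have hf' := integral_congr_ae (hf.mono fun x hx => congrArg (· * deriv ψ x) hx)
  have hg' := integral_congr_ae (hg.mono fun x hx => congrArg (· * ψ x) hx)
  exact hg'.symm.trans ((h ψ hψ).trans (congrArg Neg.neg hf'))

theorem hasWeakDeriv_const_add_primitive (hg : IntegrableOn g (Ioo a b)) (hc : c ∈ Icc a b)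
    (k : ℂ) : HasWeakDeriv a b (fun x => k + ∫ t in c..x, g t) g := by
  have hab := hc.1.trans hc.2
  have h := HasWeakDeriv.add (continuousOn_const.integrableOn_Ioo)
    (continuousOn_primitive_Icc hg (left_mem_Icc.2 hab)).integrableOn_Ioo
    integrableOn_zero hg (HasWeakDeriv.const (k - ∫ t in a..c, g t)) (hasWeakDeriv_primitive_left hg)
  refine h.congr_ae ?_ (by simp)
  filter_upwards [ae_restrict_mem measurableSet_Ioo] with x hx
  rw [← intervalIntegral.integral_add_adjacent_intervals
    (hg.intervalIntegrable_of_mem_Icc (left_mem_Icc.2 hab) hc)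
    (hg.intervalIntegrable_of_mem_Icc hc (Ioo_subset_Icc_self hx))]
  ring

/-- The du Bois-Reymond lemma. -/
theorem HasWeakDeriv.exists_ae_eq_const (hab : a < b) (hf : IntegrableOn f (Ioo a b))
    (h : HasWeakDeriv a b f fun _ => 0) : ∃ k, f =ᵐ[volume.restrict (Ioo a b)] fun _ => k := by
  obtain ⟨θ, hθ, hθ1⟩ := IsTestFunction.exists_integral_eq_one hab
  refine ⟨∫ x in Ioo a b, f x * θ x, ?_⟩
  set k := ∫ x in Ioo a b, f x * θ x with hk
  have key : ∀ ψ, IsTestFunction a b ψ → ∫ x in Ioo a b, (f x - k) * ψ x = 0 := by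
    intro ψ hψ
    -- Subtracting `m θ` makes the mean zero, so the difference is the derivative of a test function
    -- and the hypothesis applies to it.
    set m := ∫ x in Ioo a b, ψ x with hm
    obtain ⟨η, hη, hηd⟩ := (hψ.sub_const_mul hθ m).exists_deriv_eq (by
      rw [integral_sub hψ.integrable.integrableOn (hθ.integrable.integrableOn.const_mul m),
        integral_const_mul, hθ1, ← hm, mul_one, sub_self])
    have h1 := h η hη
    rw [hηd] at h1
    simp only [zero_mul, integral_zero, mul_sub] at h1
    have e : ∀ x, f x * (m * θ x) = m * (f x * θ x) := fun x => by ring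
    simp only [e] at h1
    rw [integral_sub (hψ.integrableOn_mul hf) ((hθ.integrableOn_mul hf).const_mul m),
      integral_const_mul, ← hk] at h1
    simp only [sub_mul]
    rw [integral_sub (hψ.integrableOn_mul hf) (hψ.integrable.integrableOn.const_mul k),
      integral_const_mul, ← hm]
    linear_combination h1
  have hloc : IntegrableOn (fun x => f x - k) (Ioo a b) :=
    hf.sub continuousOn_const.integrableOn_Ioo
  rw [Filter.EventuallyEq, ae_restrict_iff' measurableSet_Ioo]
  have hae := isOpen_Ioo.ae_eq_zero_of_integral_contDiff_smul_eq_zero hloc.locallyIntegrableOn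
    fun g hg hgc hgs => ?_
  · filter_upwards [hae] with x hx hxI using sub_eq_zero.1 (hx hxI)
  · have hsub : tsupport (fun x => (g x : ℂ)) ⊆ Ioo a b :=
      (tsupport_comp_subset Complex.ofReal_zero g).trans hgs
    have := key (fun x => (g x : ℂ)) ⟨Complex.ofRealCLM.contDiff.comp hg,
      hgc.comp_left Complex.ofReal_zero, hsub⟩
    rw [setIntegral_eq_integral_of_forall_compl_eq_zero] at this
    · rw [← this]
      exact integral_congr_ae (Eventually.of_forall fun x => by simp [mul_comm])
    · intro x hx
      rw [image_eq_zero_of_notMem_tsupport fun hx' => hx (hgs hx')]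
      simp

theorem HasWeakDeriv.exists_ae_eq_const_add_primitive (hab : a < b) (hc : c ∈ Icc a b)
    (hf : IntegrableOn f (Ioo a b)) (hg : IntegrableOn g (Ioo a b)) (h : HasWeakDeriv a b f g) :
    ∃ k, f =ᵐ[volume.restrict (Ioo a b)] fun x => k + ∫ t in c..x, g t := by
  have hG := (continuousOn_const (c := (0 : ℂ)).add
    (continuousOn_primitive_Icc hg hc)).integrableOn_Ioo
  have hd := HasWeakDeriv.sub hf hG hg hg h (hasWeakDeriv_const_add_primitive hg hc 0)
  simp only [sub_self] at hd
  obtain ⟨k, hk⟩ := hd.exists_ae_eq_const hab (hf.sub hG)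
  refine ⟨k, hk.mono fun x (hx : f x - (0 + ∫ t in c..x, g t) = k) => ?_⟩
  rw [← hx]; ring

end WeakDerivative

/-! ### Weak solutions as integrated first-order systems. -/

/-- `u' = w` and `w' = F` on `[a, b]` with `F` integrable, in integrated form with base point
`c`. -/
structure IsPrimitivePair (a b c : ℝ) (F u w : ℝ → ℂ) : Prop where
  integrableOn : IntegrableOn F (Ioo a b)
  fst_eq : ∀ x ∈ Icc a b, u x = u c + ∫ t in c..x, w t
  snd_eq : ∀ x ∈ Icc a b, w x = w c + ∫ t in c..x, F t

theorem MeasureTheory.IntegrableOn.mul_continuousOn_Icc {a b : ℝ} {q u : ℝ → ℂ}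
    (hq : IntegrableOn q (Ioo a b)) (hu : ContinuousOn u (Icc a b)) :
    IntegrableOn (fun t => q t * u t) (Ioo a b) :=
  (integrableOn_Icc_iff_integrableOn_Ioo).1
    (((integrableOn_Icc_iff_integrableOn_Ioo).2 hq).mul_continuousOn hu isCompact_Icc)

theorem uIoc_ae_of_Ioo {a b x y : ℝ} {P : ℝ → Prop} (hx : x ∈ Icc a b) (hy : y ∈ Icc a b)
    (h : ∀ᵐ t ∂volume.restrict (Ioo a b), P t) : ∀ᵐ t, t ∈ uIoc x y → P t := by
  rw [restrict_Ioo_eq_restrict_Icc, ae_restrict_iff' measurableSet_Icc] at h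
  filter_upwards [h] with t ht hxy
  exact ht (uIcc_subset_Icc hx hy (uIoc_subset_uIcc hxy))

namespace IsPrimitivePair

variable {a b c : ℝ} {F G u v w z : ℝ → ℂ}

theorem continuousOn_snd (h : IsPrimitivePair a b c F u w) (hc : c ∈ Icc a b) :
    ContinuousOn w (Icc a b) :=
  (continuousOn_const.add (continuousOn_primitive_Icc h.integrableOn hc)).congr h.snd_eq

theorem continuousOn_fst (h : IsPrimitivePair a b c F u w) (hc : c ∈ Icc a b) :
    ContinuousOn u (Icc a b) :=
  (continuousOn_const.add
    (continuousOn_primitive_Icc (h.continuousOn_snd hc).integrableOn_Ioo hc)).congr h.fst_eq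

theorem congr (h : IsPrimitivePair a b c F u w) (hc : c ∈ Icc a b)
    (hF : F =ᵐ[volume.restrict (Ioo a b)] G) (hu : EqOn u v (Icc a b)) (hw : EqOn w z (Icc a b)) :
    IsPrimitivePair a b c G v z where
  integrableOn := h.integrableOn.congr hF
  fst_eq x hx := by
    rw [← hu hx, ← hu hc, h.fst_eq x hx]
    congr 1
    exact intervalIntegral.integral_congr fun t ht => hw (uIcc_subset_Icc hc hx ht)
  snd_eq x hx := by
    rw [← hw hx, ← hw hc, h.snd_eq x hx]
    congr 1
    exact intervalIntegral.integral_congr_ae (uIoc_ae_of_Ioo hc hx hF)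

theorem const_mul (h : IsPrimitivePair a b c F u w) (k : ℂ) :
    IsPrimitivePair a b c (fun t => k * F t) (fun t => k * u t) (fun t => k * w t) where
  integrableOn := h.integrableOn.const_mul k
  fst_eq x hx := by rw [intervalIntegral.integral_const_mul, h.fst_eq x hx]; ring
  snd_eq x hx := by rw [intervalIntegral.integral_const_mul, h.snd_eq x hx]; ring

theorem add (h : IsPrimitivePair a b c F u w) (h' : IsPrimitivePair a b c G v z)
    (hc : c ∈ Icc a b) :
    IsPrimitivePair a b c (fun t => F t + G t) (fun t => u t + v t) (fun t => w t + z t) where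
  integrableOn := h.integrableOn.add h'.integrableOn
  fst_eq x hx := by
    rw [intervalIntegral.integral_add
      ((h.continuousOn_snd hc).integrableOn_Ioo.intervalIntegrable_of_mem_Icc hc hx)
      ((h'.continuousOn_snd hc).integrableOn_Ioo.intervalIntegrable_of_mem_Icc hc hx),
      h.fst_eq x hx, h'.fst_eq x hx]
    ring
  snd_eq x hx := by
    rw [intervalIntegral.integral_add (h.integrableOn.intervalIntegrable_of_mem_Icc hc hx)
      (h'.integrableOn.intervalIntegrable_of_mem_Icc hc hx), h.snd_eq x hx, h'.snd_eq x hx]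
    ring

theorem sub (h : IsPrimitivePair a b c F u w) (h' : IsPrimitivePair a b c G v z)
    (hc : c ∈ Icc a b) :
    IsPrimitivePair a b c (fun t => F t - G t) (fun t => u t - v t) (fun t => w t - z t) := by
  simpa only [neg_one_mul, ← sub_eq_add_neg] using h.add (h'.const_mul (-1)) hc

theorem hasDerivWithinAt (h : IsPrimitivePair a b c F u w) (hc : c ∈ Icc a b) {x : ℝ}
    (hx : x ∈ Icc a b) : HasDerivWithinAt u (w x) (Icc a b) x := by
  have hw := h.continuousOn_snd hc
  have : Fact (x ∈ Icc a b) := ⟨hx⟩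
  have := intervalIntegral.integral_hasDerivWithinAt_right (s := Icc a b) (t := Icc a b)
    (hw.integrableOn_Ioo.intervalIntegrable_of_mem_Icc hc hx)
    (hw.stronglyMeasurableAtFilter_nhdsWithin measurableSet_Icc x) (hw x hx)
  exact (this.const_add (u c)).congr h.fst_eq (h.fst_eq x hx)

theorem derivWithin_eq (h : IsPrimitivePair a b c F u w) (hab : a < b) (hc : c ∈ Icc a b) {x : ℝ}
    (hx : x ∈ Icc a b) : derivWithin u (Icc a b) x = w x :=
  (h.hasDerivWithinAt hc hx).derivWithin (uniqueDiffOn_Icc hab x hx)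

theorem isWeakSolution {q f : ℝ → ℂ} (h : IsPrimitivePair a b c (fun t => q t * u t + f t) u w)
    (hc : c ∈ Icc a b) (hq : IntegrableOn q (Ioo a b)) (hf : IntegrableOn f (Ioo a b)) :
    IsWeakSolution a b q f u := by
  have hu := h.continuousOn_fst hc
  have hw := h.continuousOn_snd hc
  have hae : ∀ᵐ x ∂volume.restrict (Ioo a b), x ∈ Icc a b :=
    (ae_restrict_mem measurableSet_Ioo).mono fun x hx => Ioo_subset_Icc_self hx
  have hu' : HasWeakDeriv a b u w :=
    (hasWeakDeriv_const_add_primitive hw.integrableOn_Ioo hc (u c)).congr_ae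
      (hae.mono fun x hx => (h.fst_eq x hx).symm) (ae_eq_refl _)
  have hw' : HasWeakDeriv a b w fun t => q t * u t + f t :=
    (hasWeakDeriv_const_add_primitive h.integrableOn hc (w c)).congr_ae
      (hae.mono fun x hx => (h.snd_eq x hx).symm) (ae_eq_refl _)
  refine ⟨⟨hu.integrableOn_Ioo, w, hw.integrableOn_Ioo, hu'⟩, fun ψ hψ => ?_⟩
  have h1 := hu' _ hψ.deriv
  have h2 := hw' _ hψ
  simp only [add_mul] at h2
  rw [integral_add (hψ.integrableOn_mul (hq.mul_continuousOn_Icc hu)) (hψ.integrableOn_mul hf)] at h2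
  have e : ∀ x, u x * (q x * ψ x) = q x * u x * ψ x := fun x => by ring
  simp only [e]
  linear_combination h1 - h2

end IsPrimitivePair

theorem IsWeakSolution.congr_ae {a b : ℝ} {q f f' u u' : ℝ → ℂ} (h : IsWeakSolution a b q f u)
    (hu : u =ᵐ[volume.restrict (Ioo a b)] u') (hf : f =ᵐ[volume.restrict (Ioo a b)] f') :
    IsWeakSolution a b q f' u' := by
  obtain ⟨hi, g, hg, hfg⟩ := h.memW11
  refine ⟨⟨hi.congr hu, g, hg, hfg.congr_ae hu (ae_eq_refl _)⟩, fun ψ hψ => ?_⟩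
  rw [← integral_congr_ae (hf.mono fun x hx => congrArg (· * ψ x) hx), ← h.eq_distrib ψ hψ,
    ← integral_congr_ae (hu.mono fun x hx => congrArg (· * deriv (deriv ψ) x) hx),
    ← integral_congr_ae (hu.mono fun x hx => congrArg (· * (q x * ψ x)) hx)]

/-- The equation, read with `ψ'` as a test function for the weak derivative `g` of `v`, says that
`g` itself has the weak derivative `q u + f`; du Bois-Reymond then applies to `g` as it did to `v`.
-/
theorem IsWeakSolution.exists_isPrimitivePair {a b c : ℝ} {q f v : ℝ → ℂ}
    (h : IsWeakSolution a b q f v) (hab : a < b) (hc : c ∈ Icc a b)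
    (hq : IntegrableOn q (Ioo a b)) (hf : IntegrableOn f (Ioo a b)) :
    ∃ u w, IsPrimitivePair a b c (fun t => q t * u t + f t) u w ∧
      v =ᵐ[volume.restrict (Ioo a b)] u := by
  obtain ⟨hv, g, hg, hvg⟩ := h.memW11
  obtain ⟨k, hk⟩ := hvg.exists_ae_eq_const_add_primitive hab hc hv hg
  set u : ℝ → ℂ := fun x => k + ∫ t in c..x, g t with hu
  have huc : ContinuousOn u (Icc a b) :=
    continuousOn_const.add (continuousOn_primitive_Icc hg hc)
  have hqu := hq.mul_continuousOn_Icc huc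
  have hF : IntegrableOn (fun t => q t * u t + f t) (Ioo a b) := hqu.add hf
  have hg' : HasWeakDeriv a b g fun t => q t * u t + f t := by
    intro ψ hψ
    have h1 := hvg _ hψ.deriv
    have h2 := h.eq_distrib ψ hψ
    rw [integral_congr_ae (hk.mono fun x hx => congrArg (· * (q x * ψ x)) hx)] at h2
    have e : ∀ x, u x * (q x * ψ x) = q x * u x * ψ x := fun x => by ring
    simp only [e] at h2
    simp only [add_mul]
    rw [integral_add (hψ.integrableOn_mul hqu) (hψ.integrableOn_mul hf)]
    linear_combination h1 - h2
  obtain ⟨m, hm⟩ := hg'.exists_ae_eq_const_add_primitive hab hc hg hF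
  refine ⟨u, fun x => m + ∫ t in c..x, (q t * u t + f t), ⟨hF, fun x hx => ?_, fun x _ => ?_⟩, hk⟩
  · simp only [hu, intervalIntegral.integral_same, add_zero]
    congr 1
    exact intervalIntegral.integral_congr_ae (uIoc_ae_of_Ioo hc hx hm)
  · simp

/-- Continuous functions that agree almost everywhere agree on all of `[a, b]`, so `v` is itself the
first component and its derivative the second. -/
theorem IsWeakSolution.isPrimitivePair {a b c : ℝ} {q f v : ℝ → ℂ}
    (h : IsWeakSolution a b q f v) (hab : a < b) (hc : c ∈ Icc a b)
    (hq : IntegrableOn q (Ioo a b)) (hf : IntegrableOn f (Ioo a b))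
    (hv : ContinuousOn v (Icc a b)) :
    IsPrimitivePair a b c (fun t => q t * v t + f t) v (derivWithin v (Icc a b)) := by
  obtain ⟨u, w, hu, hvu⟩ := h.exists_isPrimitivePair hab hc hq hf
  rw [restrict_Ioo_eq_restrict_Icc] at hvu
  have heq := Measure.eqOn_Icc_of_ae_eq volume hab.ne hvu hv (hu.continuousOn_fst hc)
  refine hu.congr hc ?_ heq.symm fun x hx => ?_
  · filter_upwards [ae_restrict_mem measurableSet_Ioo] with x hx
    rw [heq (Ioo_subset_Icc_self hx)]
  · rw [derivWithin_congr heq (heq hx), hu.derivWithin_eq hab hc hx]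

/-! ### Exponentially weighted estimates and uniqueness. -/

theorem setIntegral_uIoc_exp_le {K : ℝ} (hK : 0 < K) (c x : ℝ) :
    ∫ t in uIoc c x, Real.exp (K * |t - c|) ≤ Real.exp (K * |x - c|) / K := by
  rcases le_total c x with h | h
  · have hd : ∀ t, HasDerivAt (fun t => Real.exp (K * (t - c)) / K) (Real.exp (K * (t - c))) t := by
      intro t
      have := ((((hasDerivAt_id t).sub_const c).const_mul K).exp).div_const K
      simpa [mul_div_cancel_right₀ _ hK.ne'] using this
    rw [uIoc_of_le h, abs_of_nonneg (sub_nonneg.2 h),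
      setIntegral_congr_fun measurableSet_Ioc
        (g := fun t => Real.exp (K * (t - c))) fun t ht => by
          simp only [abs_of_nonneg (sub_nonneg.2 ht.1.le)],
      ← intervalIntegral.integral_of_le h,
      intervalIntegral.integral_eq_sub_of_hasDerivAt (fun t _ => hd t)
        (Continuous.intervalIntegrable (by fun_prop) _ _)]
    have : 0 ≤ Real.exp (K * (c - c)) / K := by positivity
    linarith
  · have hd : ∀ t, HasDerivAt (-fun t => Real.exp (K * (c - t)) / K)
        (Real.exp (K * (c - t))) t := by
      intro t
      have := (((((hasDerivAt_id t).const_sub c).const_mul K).exp).div_const K).neg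
      simpa [mul_div_cancel_right₀ _ hK.ne', neg_div] using this
    rw [uIoc_of_ge h, abs_of_nonpos (sub_nonpos.2 h), neg_sub,
      setIntegral_congr_fun measurableSet_Ioc
        (g := fun t => Real.exp (K * (c - t))) fun t ht => by
          simp only [abs_of_nonpos (sub_nonpos.2 ht.2), neg_sub],
      ← intervalIntegral.integral_of_le h,
      intervalIntegral.integral_eq_sub_of_hasDerivAt (fun t _ => hd t)
        (Continuous.intervalIntegrable (by fun_prop) _ _)]
    have : 0 ≤ Real.exp (K * (c - c)) / K := by positivity
    simp only [Pi.neg_apply]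
    linarith

theorem uIoc_subset_Icc_of_mem {a b c x : ℝ} (hc : c ∈ Icc a b) (hx : x ∈ Icc a b) :
    uIoc c x ⊆ Icc a b := uIoc_subset_uIcc.trans (uIcc_subset_Icc hc hx)

/-- Bielecki's weight: integration against an integrable density is a small operator for the norm
weighted by `exp (K |t - c|)` with `K` large. -/
theorem exists_setIntegral_mul_exp_le {a b c ε : ℝ} {p : ℝ → ℝ} (hc : c ∈ Icc a b)
    (hp : IntegrableOn p (Ioo a b)) (hε : 0 < ε) :
    ∃ K : ℝ, 0 < K ∧ ∀ x ∈ Icc a b,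
      ∫ t in uIoc c x, p t * Real.exp (K * |t - c|) ≤ ε * Real.exp (K * |x - c|) := by
  rw [← integrableOn_Icc_iff_integrableOn_Ioo] at hp
  -- Split `p` into a part of `L¹` norm at most `ε / 2` and a continuous `g` bounded by `C`. On the
  -- latter, integrating the exponential gains `1 / K`; the choice of `K` below gives `C / K ≤ ε /
  -- 2`, and `C + 1` keeps `K` positive.
  obtain ⟨g, hgc, hg, hgcont, hgi⟩ :=
    Integrable.exists_hasCompactSupport_integral_sub_le hp (half_pos hε)
  obtain ⟨C, hC⟩ := hgc.exists_bound_of_continuous hgcont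
  have hC0 : 0 ≤ C := (norm_nonneg _).trans (hC 0)
  have hK : 0 < 2 * (C + 1) / ε := by positivity
  refine ⟨2 * (C + 1) / ε, hK, fun x hx => ?_⟩
  set K := 2 * (C + 1) / ε with hKdef
  have hsub := uIoc_subset_Icc_of_mem hc hx
  have hdiff : IntegrableOn (fun t => ‖p t - g t‖) (Icc a b) := (hp.sub hgi).norm
  have hexp : IntegrableOn (fun t => Real.exp (K * |t - c|)) (uIoc c x) :=
    ((by fun_prop : Continuous fun t => Real.exp (K * |t - c|)).continuousOn.integrableOn_Icc
      (a := a) (b := b)).mono_set hsub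
  have hle : ∀ t ∈ uIoc c x, p t * Real.exp (K * |t - c|) ≤
      ‖p t - g t‖ * Real.exp (K * |x - c|) + C * Real.exp (K * |t - c|) := by
    intro t ht
    have h1 : |t - c| ≤ |x - c| := abs_sub_left_of_mem_uIcc (uIoc_subset_uIcc ht)
    have h2 : Real.exp (K * |t - c|) ≤ Real.exp (K * |x - c|) := by gcongr
    have h3 : p t ≤ ‖p t - g t‖ + C := by
      have := (Real.le_norm_self (p t - g t))
      have := (Real.le_norm_self (g t)).trans (hC t)
      linarith
    calc p t * Real.exp (K * |t - c|) ≤ (‖p t - g t‖ + C) * Real.exp (K * |t - c|) := by gcongr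
      _ ≤ _ := by rw [add_mul]; gcongr
  have hpint : IntegrableOn (fun t => p t * Real.exp (K * |t - c|)) (uIoc c x) :=
    (hp.mul_continuousOn (by fun_prop : Continuous fun t => Real.exp (K * |t - c|)).continuousOn
      isCompact_Icc).mono_set hsub
  have hCK : C / K ≤ ε / 2 := by
    rw [hKdef, div_div_eq_mul_div, div_le_div_iff₀ (by positivity) two_pos]
    nlinarith
  calc ∫ t in uIoc c x, p t * Real.exp (K * |t - c|)
      ≤ ∫ t in uIoc c x, (‖p t - g t‖ * Real.exp (K * |x - c|) + C * Real.exp (K * |t - c|)) :=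
        setIntegral_mono_on hpint (((hdiff.mono_set hsub).mul_const _).add (hexp.const_mul C))
          measurableSet_uIoc hle
    _ = (∫ t in uIoc c x, ‖p t - g t‖) * Real.exp (K * |x - c|) +
        C * ∫ t in uIoc c x, Real.exp (K * |t - c|) := by
        rw [integral_add ((hdiff.mono_set hsub).mul_const _) (hexp.const_mul C),
          integral_mul_const, integral_const_mul]
    _ ≤ ε / 2 * Real.exp (K * |x - c|) + C * (Real.exp (K * |x - c|) / K) := by
        gcongr
        · exact (setIntegral_mono_set hdiff (Eventually.of_forall fun t => norm_nonneg _)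
            hsub.eventuallyLE).trans hg
        · exact setIntegral_uIoc_exp_le hK c x
    _ = (ε / 2 + C / K) * Real.exp (K * |x - c|) := by ring
    _ ≤ (ε / 2 + ε / 2) * Real.exp (K * |x - c|) := by gcongr
    _ = ε * Real.exp (K * |x - c|) := by ring

/-- A priori bound for `u'' = q u + f` with zero initial data at `c`. -/
theorem IsPrimitivePair.norm_le_of_forcing {a b c K δ M : ℝ} {q f u w : ℝ → ℂ}
    (h : IsPrimitivePair a b c (fun t => q t * u t + f t) u w) (hc : c ∈ Icc a b)
    (hq : IntegrableOn q (Ioo a b)) (hu0 : u c = 0) (hw0 : w c = 0) (hδ : 0 < δ) (hM : 0 ≤ M)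
    (hK : ∀ x ∈ Icc a b, ∫ t in uIoc c x, (1 + ‖q t‖) * Real.exp (K * |t - c|) ≤
      δ / (1 + δ) * Real.exp (K * |x - c|))
    (hf : ∀ x ∈ Icc a b, ‖f x‖ ≤ M * Real.exp (K * |x - c|)) {x : ℝ} (hx : x ∈ Icc a b) :
    ‖u x‖ + ‖w x‖ ≤ δ * M * Real.exp (K * |x - c|) := by
  have hu := h.continuousOn_fst hc
  have hw := h.continuousOn_snd hc
  have hcont : Continuous fun t => Real.exp (K * |t - c|) := by fun_prop
  -- `N` is the weighted sup norm of `(u, w)`, attained at `y`; the integral equations need only be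
  -- estimated at this point.
  obtain ⟨y, hy, hmax⟩ := isCompact_Icc.exists_isMaxOn ⟨c, hc⟩
    ((hu.norm.add hw.norm).div hcont.continuousOn fun t _ => (Real.exp_pos _).ne')
  set N := (‖u y‖ + ‖w y‖) / Real.exp (K * |y - c|) with hN
  have hN0 : 0 ≤ N := by positivity
  have hE : ∀ t ∈ Icc a b, ‖u t‖ + ‖w t‖ ≤ N * Real.exp (K * |t - c|) := fun t ht =>
    (div_le_iff₀ (Real.exp_pos _)).1 (hmax ht)
  have hsub := uIoc_subset_Icc_of_mem hc hy
  have hFi := (integrableOn_Icc_iff_integrableOn_Ioo (by simp) (by simp)).2 h.integrableOn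
  have hwi := hw.integrableOn_Icc (μ := volume)
  have hqi : IntegrableOn (fun t => 1 + ‖q t‖) (Icc a b) :=
    continuousOn_const.integrableOn_Icc.add
      ((integrableOn_Icc_iff_integrableOn_Ioo (by simp) (by simp)).2 hq).norm
  have hbound : ‖u y‖ + ‖w y‖ ≤ δ / (1 + δ) * (N + M) * Real.exp (K * |y - c|) := by
    have h1 : ‖u y‖ ≤ ∫ t in uIoc c y, ‖w t‖ := by
      rw [h.fst_eq y hy, hu0, zero_add]
      exact intervalIntegral.norm_integral_le_integral_norm_uIoc
    have h2 : ‖w y‖ ≤ ∫ t in uIoc c y, ‖q t * u t + f t‖ := by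
      rw [h.snd_eq y hy, hw0, zero_add]
      exact intervalIntegral.norm_integral_le_integral_norm_uIoc
    have hpi : IntegrableOn (fun t => (1 + ‖q t‖) * Real.exp (K * |t - c|)) (uIoc c y) :=
      (hqi.mul_continuousOn hcont.continuousOn isCompact_Icc).mono_set hsub
    calc ‖u y‖ + ‖w y‖ ≤ (∫ t in uIoc c y, ‖w t‖) + ∫ t in uIoc c y, ‖q t * u t + f t‖ :=
          add_le_add h1 h2
      _ = ∫ t in uIoc c y, (‖w t‖ + ‖q t * u t + f t‖) :=
          (integral_add (hwi.mono_set hsub).norm (hFi.mono_set hsub).norm).symm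
      _ ≤ ∫ t in uIoc c y, (N + M) * ((1 + ‖q t‖) * Real.exp (K * |t - c|)) := by
          refine setIntegral_mono_on ((hwi.mono_set hsub).norm.add (hFi.mono_set hsub).norm)
            (hpi.const_mul _) measurableSet_uIoc fun t ht => ?_
          have e1 := hE t (hsub ht)
          have e2 := hf t (hsub ht)
          have e3 : ‖q t * u t + f t‖ ≤ ‖q t‖ * ‖u t‖ + ‖f t‖ :=
            (norm_add_le _ _).trans (by rw [norm_mul])
          have e4 : ‖q t‖ * ‖u t‖ ≤ ‖q t‖ * (N * Real.exp (K * |t - c|)) := by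
            gcongr; linarith [norm_nonneg (w t)]
          have e5 : 0 ≤ ‖q t‖ * (M * Real.exp (K * |t - c|)) := by positivity
          have e6 := norm_nonneg (u t)
          nlinarith
      _ ≤ _ := by
          rw [integral_const_mul]
          have := mul_le_mul_of_nonneg_left (hK y hy) (add_nonneg hN0 hM)
          linarith
  have hNle : N ≤ δ * M := by
    -- The constant `δ / (1 + δ)` is chosen so that absorbing `N` on the left gives exactly `N ≤ δ
    -- M`.
    have h1 : N ≤ δ / (1 + δ) * (N + M) := (div_le_iff₀ (Real.exp_pos _)).2 hbound
    rw [div_mul_eq_mul_div, le_div_iff₀ (by positivity)] at h1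
    linarith
  exact (hE x hx).trans (by gcongr)

theorem IsPrimitivePair.eq_zero {a b c : ℝ} {q u w : ℝ → ℂ}
    (h : IsPrimitivePair a b c (fun t => q t * u t) u w) (hc : c ∈ Icc a b)
    (hq : IntegrableOn q (Ioo a b)) (hu0 : u c = 0) (hw0 : w c = 0) {x : ℝ} (hx : x ∈ Icc a b) :
    u x = 0 ∧ w x = 0 := by
  -- The a priori bound with `δ = 1` and forcing bound `M = 0`.
  obtain ⟨K, -, hK⟩ := exists_setIntegral_mul_exp_le (p := fun t => 1 + ‖q t‖) hc
    (continuousOn_const.integrableOn_Icc.mono_set Ioo_subset_Icc_self |>.add hq.norm)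
    (ε := 1 / (1 + 1)) (by norm_num)
  have := IsPrimitivePair.norm_le_of_forcing (f := fun _ => 0) (M := 0) (by simpa using h) hc hq
    hu0 hw0 one_pos le_rfl hK (by simp) hx
  have h1 := norm_nonneg (u x)
  have h2 := norm_nonneg (w x)
  simp only [mul_zero, zero_mul] at this
  exact ⟨norm_eq_zero.1 (by linarith), norm_eq_zero.1 (by linarith)⟩

/-! ### Convergence of the perturbation series. -/

/-- Geometric decay of the terms of the perturbation series for `u'' - q u = lam u`. -/
theorem exists_geometric_bound {a b c : ℝ} {q : ℝ → ℂ} {lam : ℂ} {t d : ℕ → ℝ → ℂ}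
    (hc : c ∈ Icc a b) (hq : IntegrableOn q (Ioo a b))
    (h0 : IsPrimitivePair a b c (fun x => q x * t 0 x) (t 0) (d 0))
    (hs : ∀ n, IsPrimitivePair a b c (fun x => q x * t (n + 1) x + lam * t n x)
      (t (n + 1)) (d (n + 1)))
    (ht : ∀ n, t (n + 1) c = 0) (hd : ∀ n, d (n + 1) c = 0) :
    ∃ B : ℝ, 0 ≤ B ∧ ∀ n, ∀ x ∈ Icc a b, ‖t n x‖ + ‖d n x‖ ≤ B * (1 / 2) ^ n := by
  -- Each step multiplies the weighted norm by at most `δ ‖lam‖ ≤ 1 / 2`; the `+ 1` allows `lam =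
  -- 0`.
  set δ : ℝ := 1 / (2 * (‖lam‖ + 1)) with hδdef
  have hδ : 0 < δ := by positivity
  have hδl : δ * ‖lam‖ ≤ 1 / 2 := by
    rw [hδdef, div_mul_eq_mul_div, div_le_div_iff₀ (by positivity) two_pos]
    linarith
  obtain ⟨K, hK0, hK⟩ := exists_setIntegral_mul_exp_le (p := fun t => 1 + ‖q t‖) hc
    (continuousOn_const.integrableOn_Icc.mono_set Ioo_subset_Icc_self |>.add hq.norm)
    (ε := δ / (1 + δ)) (by positivity)
  obtain ⟨M, hM⟩ := isCompact_Icc.exists_bound_of_continuousOn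
    ((h0.continuousOn_fst hc).norm.add (h0.continuousOn_snd hc).norm)
  have hM0 : 0 ≤ M := (norm_nonneg _).trans (hM c hc)
  have hexp1 : ∀ x, 1 ≤ Real.exp (K * |x - c|) := fun x => Real.one_le_exp (by positivity)
  have key : ∀ n, ∀ x ∈ Icc a b,
      ‖t n x‖ + ‖d n x‖ ≤ M * (1 / 2) ^ n * Real.exp (K * |x - c|) := by
    intro n
    induction n with
    | zero =>
      intro x hx
      have := (Real.le_norm_self _).trans (hM x hx)
      rw [pow_zero, mul_one]
      exact this.trans (le_mul_of_one_le_right hM0 (hexp1 x))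
    | succ n ih =>
      intro x hx
      refine ((hs n).norm_le_of_forcing hc hq (ht n) (hd n) hδ
        (M := ‖lam‖ * (M * (1 / 2) ^ n)) (by positivity) hK (fun y hy => ?_) hx).trans ?_
      · rw [norm_mul, mul_assoc]
        gcongr
        exact (le_add_of_nonneg_right (norm_nonneg _)).trans (ih y hy)
      · refine mul_le_mul_of_nonneg_right ?_ (Real.exp_pos _).le
        calc δ * (‖lam‖ * (M * (1 / 2) ^ n)) = δ * ‖lam‖ * (M * (1 / 2) ^ n) := by ring
          _ ≤ 1 / 2 * (M * (1 / 2) ^ n) := by gcongr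
          _ = M * (1 / 2) ^ (n + 1) := by ring
  obtain ⟨R, hR⟩ := isCompact_Icc (a := a) (b := b) |>.exists_bound_of_continuousOn
    (by fun_prop : Continuous fun x => Real.exp (K * |x - c|)).continuousOn
  have hR0 : 0 ≤ R := (norm_nonneg _).trans (hR c hc)
  refine ⟨M * R, by positivity, fun n x hx => (key n x hx).trans ?_⟩
  rw [mul_right_comm]
  gcongr
  exact (Real.le_norm_self _).trans (hR x hx)

/-- Dominated convergence, the sum of the bounds being a multiple of `p`. The factor `p` is there
for the terms `q * t n`, where it is `‖q‖`. -/
theorem hasSum_intervalIntegral_of_geometric_bound {a b c B : ℝ} {G : ℕ → ℝ → ℂ} {S : ℝ → ℂ}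
    {p : ℝ → ℝ} (hc : c ∈ Icc a b) (hp : IntegrableOn p (Ioo a b))
    (hG : ∀ n, IntegrableOn (G n) (Ioo a b))
    (hle : ∀ n, ∀ x ∈ Icc a b, ‖G n x‖ ≤ p x * (B * (1 / 2) ^ n))
    (hS : ∀ x ∈ Icc a b, HasSum (fun n => G n x) (S x)) {x : ℝ} (hx : x ∈ Icc a b) :
    HasSum (fun n => ∫ t in c..x, G n t) (∫ t in c..x, S t) := by
  have hsub := uIoc_subset_Icc_of_mem hc hx
  have hgeom : Summable fun n : ℕ => B * (1 / 2 : ℝ) ^ n := summable_geometric_two.mul_left B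
  refine intervalIntegral.hasSum_integral_of_dominated_convergence
    (fun n t => p t * (B * (1 / 2) ^ n))
    (fun n => ((integrableOn_Icc_iff_integrableOn_Ioo (by simp) (by simp)).2
      (hG n)).aestronglyMeasurable.mono_set hsub)
    (fun n => Eventually.of_forall fun t ht => hle n t (hsub ht))
    (Eventually.of_forall fun t _ => hgeom.mul_left _) ?_
    (Eventually.of_forall fun t ht => hS t (hsub ht))
  simp only [tsum_mul_left]
  refine (intervalIntegrable_iff.2 ?_).mul_const _
  exact ((integrableOn_Icc_iff_integrableOn_Ioo (by simp) (by simp)).2 hp).mono_set hsub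

/-- The perturbation series for `u'' - q u = lam u` sums, together with the series of derivatives,
to a solution. -/
theorem perturbationSeries {a b c : ℝ} {q : ℝ → ℂ} {lam : ℂ} {t d : ℕ → ℝ → ℂ}
    (hc : c ∈ Icc a b) (hq : IntegrableOn q (Ioo a b))
    (h0 : IsPrimitivePair a b c (fun x => q x * t 0 x) (t 0) (d 0))
    (hs : ∀ n, IsPrimitivePair a b c (fun x => q x * t (n + 1) x + lam * t n x)
      (t (n + 1)) (d (n + 1)))
    (ht : ∀ n, t (n + 1) c = 0) (hd : ∀ n, d (n + 1) c = 0) :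
    IsPrimitivePair a b c (fun x => q x * (∑' n, t n x) + lam * ∑' n, t n x)
      (fun x => ∑' n, t n x) (fun x => ∑' n, d n x) ∧
    TendstoUniformlyOn (fun N x => ∑ n ∈ Finset.range N, t n x) (fun x => ∑' n, t n x) atTop
      (Icc a b) ∧
    TendstoUniformlyOn (fun N x => ∑ n ∈ Finset.range N, d n x) (fun x => ∑' n, d n x) atTop
      (Icc a b) := by
  obtain ⟨B, hB, hBt⟩ := exists_geometric_bound hc hq h0 hs ht hd
  have hgeom : Summable fun n : ℕ => B * (1 / 2 : ℝ) ^ n := summable_geometric_two.mul_left B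
  have htB : ∀ n, ∀ x ∈ Icc a b, ‖t n x‖ ≤ B * (1 / 2) ^ n := fun n x hx =>
    (le_add_of_nonneg_right (norm_nonneg _)).trans (hBt n x hx)
  have hdB : ∀ n, ∀ x ∈ Icc a b, ‖d n x‖ ≤ B * (1 / 2) ^ n := fun n x hx =>
    (le_add_of_nonneg_left (norm_nonneg _)).trans (hBt n x hx)
  have htu := tendstoUniformlyOn_tsum_nat hgeom htB
  have hdu := tendstoUniformlyOn_tsum_nat hgeom hdB
  have hsumt : ∀ x ∈ Icc a b, Summable fun n => t n x := fun x hx =>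
    hgeom.of_norm_bounded fun n => htB n x hx
  have hsumd : ∀ x ∈ Icc a b, Summable fun n => d n x := fun x hx =>
    hgeom.of_norm_bounded fun n => hdB n x hx
  have htc : ∀ n, ContinuousOn (t n) (Icc a b) := fun n =>
    n.casesOn (h0.continuousOn_fst hc) fun n => (hs n).continuousOn_fst hc
  have hdc : ∀ n, ContinuousOn (d n) (Icc a b) := fun n =>
    n.casesOn (h0.continuousOn_snd hc) fun n => (hs n).continuousOn_snd hc
  have hVc : ContinuousOn (fun x => ∑' n, t n x) (Icc a b) := continuousOn_tsum htc hgeom htB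
  have hqt : ∀ n, IntegrableOn (fun x => q x * t n x) (Ioo a b) := fun n =>
    hq.mul_continuousOn_Icc (htc n)
  refine ⟨⟨(hq.mul_continuousOn_Icc hVc).add (hVc.integrableOn_Ioo.const_mul lam), fun x hx => ?_,
    fun x hx => ?_⟩, htu, hdu⟩
  · have h1 : HasSum (fun n => ∫ s in c..x, d n s) (∫ s in c..x, ∑' n, d n s) :=
      hasSum_intervalIntegral_of_geometric_bound (p := fun _ => 1) hc
        (continuousOn_const.integrableOn_Icc.mono_set Ioo_subset_Icc_self)
        (fun n => (hdc n).integrableOn_Ioo) (fun n y hy => by rw [one_mul]; exact hdB n y hy)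
        (fun y hy => (hsumd y hy).hasSum) hx
    refine ((hsumt x hx).hasSum.unique ?_)
    refine ((hsumt c hc).hasSum.add h1).congr_fun fun n => ?_
    cases n with
    | zero => exact h0.fst_eq x hx
    | succ n => exact (hs n).fst_eq x hx
  · have h1 : HasSum (fun n => ∫ s in c..x, q s * t n s) (∫ s in c..x, q s * ∑' n, t n s) :=
      hasSum_intervalIntegral_of_geometric_bound (p := fun s => ‖q s‖) hc hq.norm hqt
        (fun n y hy => by rw [norm_mul]; gcongr; exact htB n y hy)
        (fun y hy => (hsumt y hy).hasSum.mul_left _) hx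
    have h2 : HasSum (fun n => ∫ s in c..x, lam * t n s) (∫ s in c..x, lam * ∑' n, t n s) :=
      hasSum_intervalIntegral_of_geometric_bound (p := fun _ => ‖lam‖) hc
        (continuousOn_const.integrableOn_Icc.mono_set Ioo_subset_Icc_self)
        (fun n => (htc n).integrableOn_Ioo.const_mul lam)
        (fun n y hy => by rw [norm_mul]; gcongr; exact htB n y hy)
        (fun y hy => (hsumt y hy).hasSum.mul_left _) hx
    rw [intervalIntegral.integral_add
      ((hq.mul_continuousOn_Icc hVc).intervalIntegrable_of_mem_Icc hc hx)
      (IntegrableOn.intervalIntegrable_of_mem_Icc (hVc.integrableOn_Ioo.const_mul lam) hc hx)]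
    have hdx := hsumd x hx
    have hdc' := hsumd c hc
    -- The zeroth term has no forcing and term `n + 1` has forcing `lam * t n`: after the shift the
    -- `q`-sum lacks its first term while the `lam`-sum is complete.
    rw [hdx.tsum_eq_zero_add, hdc'.tsum_eq_zero_add]
    have e0 := h0.snd_eq x hx
    have hz : ∑' n, d (n + 1) c = 0 := by simp [hd]
    have h3 : HasSum (fun n => d (n + 1) x)
        (((∫ s in c..x, q s * ∑' n, t n s) - ∫ s in c..x, q s * t 0 s) +
          ∫ s in c..x, lam * ∑' n, t n s) := by
      have h1' : HasSum (fun n => ∫ s in c..x, q s * t (n + 1) s)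
          ((∫ s in c..x, q s * ∑' n, t n s) - ∫ s in c..x, q s * t 0 s) := by
        refine (hasSum_nat_add_iff (f := fun n => ∫ s in c..x, q s * t n s) 1).2 ?_
        simpa using h1
      refine (h1'.add h2).congr_fun fun n => ?_
      rw [(hs n).snd_eq x hx, hd, zero_add, intervalIntegral.integral_add
        ((hqt (n + 1)).intervalIntegrable_of_mem_Icc hc hx)
        (IntegrableOn.intervalIntegrable_of_mem_Icc ((htc n).integrableOn_Ioo.const_mul lam)
          hc hx)]
    rw [h3.tsum_eq, hz, e0]
    ring

/-! ### The series built from a standard `L`-base. -/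

section LBase

variable {a b c : ℝ} {q : ℝ → ℂ} {φ : ℕ → ℝ → ℂ}

theorem IsLBase.isPrimitivePair_of_lt_two (hφ : IsLBase a b q φ) (hab : a < b) (hc : c ∈ Icc a b)
    (hq : IntegrableOn q (Ioo a b)) {k : ℕ} (hk : k < 2) :
    IsPrimitivePair a b c (fun t => q t * φ k t) (φ k) (derivWithin (φ k) (Icc a b)) := by
  have h : IsWeakSolution a b q (fun _ => 0) (φ k) := by
    interval_cases k
    exacts [hφ.zero, hφ.one]
  simpa using h.isPrimitivePair hab hc hq integrableOn_zero (hφ.continuousOn k)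

theorem IsLBase.isPrimitivePair_add_two (hφ : IsLBase a b q φ) (hab : a < b) (hc : c ∈ Icc a b)
    (hq : IntegrableOn q (Ioo a b)) (k : ℕ) :
    IsPrimitivePair a b c (fun t => q t * φ (k + 2) t + ((k : ℂ) + 2) * ((k : ℂ) + 1) * φ k t)
      (φ (k + 2)) (derivWithin (φ (k + 2)) (Icc a b)) :=
  (hφ.add_two k).isPrimitivePair hab hc hq ((hφ.continuousOn k).integrableOn_Ioo.const_mul _)
    (hφ.continuousOn (k + 2))

/-- The terms of the series `∑ lam ^ n φ_{2n + r} / (2n + r)!` for `r = 0, 1`. -/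
theorem IsStandardLBase.perturbationSeries (hφ : IsStandardLBase a b q φ) (hab : a < b)
    (h0 : 0 ∈ Icc a b) (hq : IntegrableOn q (Ioo a b)) (lam : ℂ) {r : ℕ} (hr : r < 2) :
    let t : ℕ → ℝ → ℂ := fun n x => lam ^ n * (φ (2 * n + r) x / ((2 * n + r).factorial : ℂ))
    let d : ℕ → ℝ → ℂ := fun n x =>
      lam ^ n * (derivWithin (φ (2 * n + r)) (Icc a b) x / ((2 * n + r).factorial : ℂ))
    (IsPrimitivePair a b 0 (fun x => q x * (∑' n, t n x) + lam * ∑' n, t n x)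
      (fun x => ∑' n, t n x) (fun x => ∑' n, d n x) ∧
    TendstoUniformlyOn (fun N x => ∑ n ∈ Finset.range N, t n x) (fun x => ∑' n, t n x) atTop
      (Icc a b) ∧
    TendstoUniformlyOn (fun N x => ∑ n ∈ Finset.range N, d n x) (fun x => ∑' n, d n x) atTop
      (Icc a b)) ∧ (∑' n, t n 0 = φ r 0) ∧ ∑' n, d n 0 = derivWithin (φ r) (Icc a b) 0 := by
  intro t d
  have hfac : (r.factorial : ℂ) = 1 := by interval_cases r <;> simp
  have ht : ∀ n, t (n + 1) 0 = 0 := fun n => by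
    simp [t, hφ.apply_zero (2 * (n + 1) + r) (by omega)]
  have hd : ∀ n, d (n + 1) 0 = 0 := fun n => by
    simp [d, hφ.deriv_zero (2 * (n + 1) + r) (by omega)]
  refine ⟨_root_.perturbationSeries h0 hq ?_ (fun n => ?_) ht hd, ?_, ?_⟩
  · simpa [t, d, hfac] using hφ.toIsLBase.isPrimitivePair_of_lt_two hab h0 hq hr
  -- With `k = 2 * n + r`, the factor `(k + 2) (k + 1)` of the recursion reduces `1 / (k + 2)!` to
  -- `1 / k!`, which turns the forcing into `lam * t n`.
  · have h := (hφ.toIsLBase.isPrimitivePair_add_two hab h0 hq (2 * n + r)).const_mul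
      (lam ^ (n + 1) / ((2 * n + r + 2).factorial : ℂ))
    have e : 2 * (n + 1) + r = 2 * n + r + 2 := by ring
    have hf : ((2 * n + r).factorial : ℂ) ≠ 0 := by exact_mod_cast Nat.factorial_ne_zero _
    have hf1 : ((2 * n + r : ℕ) : ℂ) + 1 ≠ 0 := Nat.cast_add_one_ne_zero _
    have hf2 : ((2 * n + r : ℕ) : ℂ) + 2 ≠ 0 := by
      exact_mod_cast Nat.succ_ne_zero (2 * n + r + 1)
    have hfs : ((2 * n + r + 2).factorial : ℂ) =
        (((2 * n + r : ℕ) : ℂ) + 2) * (((2 * n + r : ℕ) : ℂ) + 1) * (2 * n + r).factorial := by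
      rw [Nat.factorial_succ, Nat.factorial_succ]
      push_cast
      ring
    refine h.congr h0 (Eventually.of_forall fun x => ?_) (fun x _ => ?_) fun x _ => ?_
    · simp only [t, e, hfs, pow_succ]
      field_simp
    · simp only [t, e]; ring
    · simp only [d, e]; ring
  · rw [tsum_eq_single 0 fun n hn => by
      obtain ⟨m, rfl⟩ := Nat.exists_eq_succ_of_ne_zero hn; exact ht m]
    simp [t, hfac]
  · rw [tsum_eq_single 0 fun n hn => by
      obtain ⟨m, rfl⟩ := Nat.exists_eq_succ_of_ne_zero hn; exact hd m]
    simp [d, hfac]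

end LBase

/-! ### The Wronskian and the general solution. -/

/-- If the Wronskian of two solutions of `u'' = q u` vanishes at the base point, then it vanishes
identically. -/
theorem IsPrimitivePair.wronskian_eq_zero {a b c : ℝ} {q u w v z : ℝ → ℂ}
    (hu : IsPrimitivePair a b c (fun t => q t * u t) u w)
    (hv : IsPrimitivePair a b c (fun t => q t * v t) v z) (hc : c ∈ Icc a b)
    (hq : IntegrableOn q (Ioo a b)) (hW : u c * z c - w c * v c = 0) {x : ℝ} (hx : x ∈ Icc a b) :
    u x * z x - w x * v x = 0 := by
  -- A linear relation between the Cauchy data at `c` persists everywhere by uniqueness.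
  have comb : ∀ k l : ℂ, k * u c = l * v c → k * w c = l * z c →
      k * u x = l * v x ∧ k * w x = l * z x := by
    intro k l h1 h2
    have h : IsPrimitivePair a b c (fun t => q t * (k * u t - l * v t))
        (fun t => k * u t - l * v t) (fun t => k * w t - l * z t) :=
      ((hu.const_mul k).sub (hv.const_mul l) hc).congr hc
        (Eventually.of_forall fun t => by ring) (fun _ _ => rfl) fun _ _ => rfl
    have := h.eq_zero hc hq (sub_eq_zero.2 h1) (sub_eq_zero.2 h2) hx
    exact ⟨sub_eq_zero.1 this.1, sub_eq_zero.1 this.2⟩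
  have aux : ∀ k l : ℂ, (k ≠ 0 ∨ l ≠ 0) → k * u c = l * v c → k * w c = l * z c →
      u x * z x - w x * v x = 0 := by
    intro k l hkl h1 h2
    obtain ⟨e1, e2⟩ := comb k l h1 h2
    rcases hkl with hk | hl
    · refine (mul_eq_zero.1 ?_).resolve_left hk
      linear_combination z x * e1 - v x * e2
    · refine (mul_eq_zero.1 ?_).resolve_left hl
      linear_combination w x * e1 - u x * e2
  -- The zero Wronskian makes the data dependent: either row of the data matrix supplies
  -- coefficients if it is nonzero, and if both rows vanish then `u` is zero.
  by_cases h1 : v c ≠ 0 ∨ u c ≠ 0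
  · exact aux (v c) (u c) h1 (by ring) (by linear_combination -hW)
  · by_cases h2 : z c ≠ 0 ∨ w c ≠ 0
    · exact aux (z c) (w c) h2 (by linear_combination hW) (by ring)
    · push Not at h1 h2
      exact aux 1 0 (Or.inl one_ne_zero) (by simp [h1]) (by simp [h2])

theorem mainTheorem4 (a : ℝ) (ha : 0 < a) (q : ℝ → ℂ) (hq : IntegrableOn q (Ioo (-a) a))
    (φ : ℕ → ℝ → ℂ) (hφ : IsStandardLBase (-a) a q φ)
    (hW : ∃ x ∈ Icc (-a) a, wronskianOn (-a) a (φ 0) (φ 1) x ≠ 0) (lam : ℂ) :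
    (∀ v : ℝ → ℂ, IsWeakSolution (-a) a q (fun x => lam * v x) v ↔
      ∃ c₁ c₂ : ℂ, ∀ᵐ x ∂(volume.restrict (Ioo (-a) a)),
        v x = c₁ * sppsEven φ lam x + c₂ * sppsOdd φ lam x) ∧
    TendstoUniformlyOn
      (fun (N : ℕ) (x : ℝ) => ∑ k ∈ Finset.range N, lam ^ k * (φ (2 * k) x / ((2 * k).factorial : ℂ)))
      (sppsEven φ lam) atTop (Icc (-a) a) ∧
    TendstoUniformlyOn
      (fun (N : ℕ) (x : ℝ) =>
        ∑ k ∈ Finset.range N, lam ^ k * (φ (2 * k + 1) x / ((2 * k + 1).factorial : ℂ)))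
      (sppsOdd φ lam) atTop (Icc (-a) a) ∧
    TendstoUniformlyOn
      (fun (N : ℕ) (x : ℝ) => ∑ k ∈ Finset.range N,
        lam ^ k * (derivWithin (φ (2 * k)) (Icc (-a) a) x / ((2 * k).factorial : ℂ)))
      (derivWithin (sppsEven φ lam) (Icc (-a) a)) atTop (Icc (-a) a) ∧
    TendstoUniformlyOn
      (fun (N : ℕ) (x : ℝ) => ∑ k ∈ Finset.range N,
        lam ^ k * (derivWithin (φ (2 * k + 1)) (Icc (-a) a) x / ((2 * k + 1).factorial : ℂ)))
      (derivWithin (sppsOdd φ lam) (Icc (-a) a)) atTop (Icc (-a) a) := by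
  have hab : -a < a := by linarith
  have h0 : (0 : ℝ) ∈ Icc (-a) a := ⟨by linarith, ha.le⟩
  obtain ⟨⟨hP₁, hU₁, hD₁⟩, hv₁, hd₁⟩ := hφ.perturbationSeries hab h0 hq lam (r := 0) two_pos
  obtain ⟨⟨hP₂, hU₂, hD₂⟩, hv₂, hd₂⟩ := hφ.perturbationSeries hab h0 hq lam (r := 1) one_lt_two
  simp only [add_zero] at hP₁ hU₁ hD₁ hv₁ hd₁
  beta_reduce at hP₂ hd₂
  change sppsEven φ lam 0 = φ 0 0 at hv₁
  change sppsOdd φ lam 0 = φ 1 0 at hv₂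
  have hL : IntegrableOn (fun t => q t + lam) (Ioo (-a) a) :=
    hq.add continuousOn_const.integrableOn_Ioo
  refine ⟨fun v => ⟨fun hv => ?_, ?_⟩, hU₁, hU₂, hD₁.congr_right fun x hx => ?_,
    hD₂.congr_right fun x hx => ?_⟩
  · obtain ⟨u, w, hu, hvu⟩ :=
      hv.exists_isPrimitivePair hab h0 hq (hv.memW11.1.const_mul lam)
    -- The Wronskian is nonzero at some point; it is needed at `0`, where the data of the two series
    -- are known.
    have hW0 : φ 0 0 * derivWithin (φ 1) (Icc (-a) a) 0 -
        derivWithin (φ 0) (Icc (-a) a) 0 * φ 1 0 ≠ 0 := by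
      intro hW0
      obtain ⟨x, hx, hWx⟩ := hW
      exact hWx ((hφ.toIsLBase.isPrimitivePair_of_lt_two hab h0 hq two_pos).wronskian_eq_zero
        (hφ.toIsLBase.isPrimitivePair_of_lt_two hab h0 hq one_lt_two) h0 hq hW0 hx)
    set D := φ 0 0 * derivWithin (φ 1) (Icc (-a) a) 0 -
        derivWithin (φ 0) (Icc (-a) a) 0 * φ 1 0 with hD
    -- Cramer's rule for matching the data `u 0`, `w 0`.
    set c₁ := (u 0 * derivWithin (φ 1) (Icc (-a) a) 0 - w 0 * φ 1 0) / D with hc₁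
    set c₂ := (w 0 * φ 0 0 - u 0 * derivWithin (φ 0) (Icc (-a) a) 0) / D with hc₂
    refine ⟨c₁, c₂, ?_⟩
    have hdiff := hu.sub ((hP₁.const_mul c₁).add (hP₂.const_mul c₂) h0) h0
    -- Replacing the forcing `lam * v` by `lam * u` almost everywhere makes the difference solve a
    -- homogeneous equation with potential `q + lam`.
    have hdiff' := hdiff.congr (G := fun t => (q t + lam) * (u t -
        (c₁ * sppsEven φ lam t + c₂ * sppsOdd φ lam t))) h0 (hvu.mono fun t ht => by
      simp only [ht, sppsEven, sppsOdd]; ring) (fun _ _ => rfl) fun _ _ => rfl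
    filter_upwards [hvu, ae_restrict_mem measurableSet_Ioo] with x hx hxI
    rw [hx]
    refine sub_eq_zero.1 (hdiff'.eq_zero h0 hL ?_ ?_ (Ioo_subset_Icc_self hxI)).1
    · rw [hv₁, hv₂, hc₁, hc₂]
      field_simp
      rw [hD]; ring
    · rw [hd₁, hd₂, hc₁, hc₂]
      field_simp
      rw [hD]; ring
  · rintro ⟨c₁, c₂, hv⟩
    have hP := (hP₁.const_mul c₁).add (hP₂.const_mul c₂) h0
    have hP' := hP.congr (G := fun t => q t * (c₁ * sppsEven φ lam t + c₂ * sppsOdd φ lam t) +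
      lam * (c₁ * sppsEven φ lam t + c₂ * sppsOdd φ lam t)) h0
      (Eventually.of_forall fun t => by simp only [sppsEven, sppsOdd]; ring)
      (fun _ _ => rfl) fun _ _ => rfl
    have hweak := hP'.isWeakSolution h0 hq ((hP'.continuousOn_fst h0).integrableOn_Ioo.const_mul lam)
    exact hweak.congr_ae (hv.mono fun x hx => hx.symm) (hv.mono fun x hx => by simp only [hx])
  · exact (hP₁.derivWithin_eq hab h0 hx).symm
  · exact (hP₂.derivWithin_eq hab h0 hx).symm
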